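/- Let $E,F,G,H$ be real Banach spaces, let $X\subseteq G$ and $Y\subseteq H$ be open, let $1\le p<\infty$ be an integer and $0\le q\le\infty$. For $k\ge 0$ let $\mathcal S^k(G,E)$ be the space of bounded symmetric $k$-linear maps $G^k\to E$ (with $\mathcal S^0(G,E)=E$). Assume that there is a $C^p$ function $\varphi:G\to\mathbb R$ with $\varphi(x)=1$ for $\|x\|\le\frac12$, $\varphi(x)=0$ for $\|x\|\ge1$ and $\sup_{x\in G}\|D^k\varphi(x)\|<\infty$ for $0\le k\le p$. Give $C^p(X,E)$ the topology generated by the seminorms $\rho_{K,k}(f)=\sup_{x\in K}\sup_{0\le j\le k}\|D^jf(x)\|$, where $K\subseteq X$ is compact and $k\le p$ is a nonnegative integer, and give $C^q(Y,F)$ the corresponding topology. Let $T:C^p(X,E)\to C^q(Y,F)$ be a continuous linear operator that is separating (if for every $x\in X$ one has $f(x)=0$ or $g(x)=0$, then for every $y\in Y$ one has $Tf(y)=0$ or $Tg(y)=0$) and nowhere trivial (for every $y\in Y$ there is $f$ with $Tf(y)\ne0$). Let $\mathcal AX$ be the closure of the image of $X$ under $x\mapsto(\psi(x))_{\psi\in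 C^p(X,\mathbb R)}$ in $\mathbb R_\infty^{C^p(X,\mathbb R)}$, where $\mathbb R_\infty$ is the one-point compactification of $\mathbb R$; regard $X$ as a subset of $\mathcal AX$. Let $h:Y\to X$ be the support map of $T$: $h(y)$ is the unique point of $\bigcap_U\overline U$, where $U$ runs over the open subsets of $\mathcal AX$ that contain the closure in $\mathcal AX$ of $\{x\in X:f(x)\ne0\}$ for some $f\in C^p(X,E)$ with $Tf(y)\neq0$. For integers $0\le k\le p$, $y\in Y$ and $S\in\mathcal S^k(G,E)$ put $$\Phi_k(y,S)=\tfrac1{k!}\,(Tf_{y,S})(y),\qquad f_{y,S}(x)=S(x-h(y),\dots,x-h(y));$$ these are the coefficients in the representation $Tf(y)=\sum_{k=0}^p\Phi_k(y,D^kf(h(y)))$. Let $y_0\in Y$ and let $0\le i\le p$ be an integer such that $\Phi_i(y_0,\cdot)\ne0$. Then for every integer $q'$ with $0\le q'\le q$ there are $r>0$ and $C<\infty$ such that $B(y_0,r)\subseteq Y$ and $$\|h(y)-h(y_0)\|^{p-i}\le C\|y-y_0\|^{q'}\qquad\text{for all }y\in B(y_0,r)\text{ with }h(y)\ne h(y_0).$$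 (For $i<p$ the restriction $h(y)\ne h(y_0)$ changes nothing, provided $C\ge 0$, which may be assumed. For $i=p$ it amounts to the convention $0^0=0$ on the left-hand side, so that if $q'\geq 1$ the statement says that $h$ is constant near $y_0$.) -/

import Mathlib

namespace SepOp

open Set Filter Topology TopologicalSpace

set_option linter.unusedSectionVars false

universe u v

section Spaces

variable {G : Type u} [NormedAddCommGroup G] [NormedSpace ℝ G]
variable {E : Type v} [NormedAddCommGroup E] [NormedSpace ℝ E]

/-- Extension by zero of a function on the open set `X` to the whole space. On the open set `X` the
derivatives of a function `f : X → E` are those of this extension. -/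
noncomputable def zeroExt (X : Opens G) (f : X → E) : G → E :=
  Function.extend ((↑) : X → G) f 0

theorem zeroExt_apply (X : Opens G) (f : X → E) (x : X) : zeroExt X f x = f x :=
  Subtype.val_injective.extend_apply f 0 x

theorem zeroExt_zero (X : Opens G) : zeroExt X (0 : X → E) = 0 := by
  funext x
  by_cases hx : x ∈ X
  · exact zeroExt_apply X 0 ⟨x, hx⟩
  · exact Function.extend_apply' _ _ _ (by rintro ⟨a, rfl⟩; exact hx a.2)

theorem zeroExt_add (X : Opens G) (f g : X → E) :
    zeroExt X (f + g) = zeroExt X f + zeroExt X g := by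
  unfold zeroExt
  rw [← Function.extend_add, add_zero]

theorem zeroExt_smul (X : Opens G) (c : ℝ) (f : X → E) :
    zeroExt X (c • f) = c • zeroExt X f := by
  unfold zeroExt
  rw [← Function.extend_smul, smul_zero]

/-- `C^p(X, E)`, as a vector space of functions `X → E`; here `0 ≤ p ≤ ∞`. -/
def ckSubmodule (p : ℕ∞) (X : Opens G) (E : Type v) [NormedAddCommGroup E] [NormedSpace ℝ E] :
    Submodule ℝ (X → E) where
  carrier := {f | ContDiffOn ℝ p (zeroExt X f) X}
  zero_mem' := by
    simp only [mem_ofPred_eq, zeroExt_zero]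
    exact contDiffOn_const
  add_mem' := by
    intro f g hf hg
    simp only [mem_ofPred_eq, zeroExt_add] at *
    exact ContDiffOn.add hf hg
  smul_mem' := by
    intro c f hf
    simp only [mem_ofPred_eq, zeroExt_smul] at *
    exact ContDiffOn.const_smul c hf

/-- The space `C^p(X, E)` (a type of its own, as it does not carry the topology of pointwise
convergence). -/
def Ck (p : ℕ∞) (X : Opens G) (E : Type v) [NormedAddCommGroup E] [NormedSpace ℝ E] :
    Type (max u v) :=
  ckSubmodule p X E

variable {p : ℕ∞} {X : Opens G}

noncomputable instance : AddCommGroup (Ck p X E) :=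
  inferInstanceAs (AddCommGroup (ckSubmodule p X E))

noncomputable instance : Module ℝ (Ck p X E) :=
  inferInstanceAs (Module ℝ (ckSubmodule p X E))

instance : FunLike (Ck p X E) X E where
  coe f := f.1
  coe_injective := Subtype.val_injective

/-- The `j`-th Fréchet derivative `D^j f(x)`. -/
noncomputable def Ck.deriv (f : Ck p X E) (j : ℕ) (x : X) :
    ContinuousMultilinearMap ℝ (fun _ : Fin j => G) E :=
  iteratedFDeriv ℝ j (zeroExt X f) x

theorem Ck.contDiffAt (f : Ck p X E) (x : X) : ContDiffAt ℝ p (zeroExt X f) x :=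
  ContDiffOn.contDiffAt f.2 (X.isOpen.mem_nhds x.2)

theorem Ck.continuous_deriv (f : Ck p X E) {j : ℕ} (hj : (j : ℕ∞) ≤ p) :
    Continuous (f.deriv j) :=
  continuous_iff_continuousAt.2 fun x =>
    ((f.contDiffAt x).continuousAt_iteratedFDeriv (mod_cast hj)).comp
      continuous_subtype_val.continuousAt

theorem Ck.deriv_zero (j : ℕ) (x : X) : (0 : Ck p X E).deriv j x = 0 := by
  have h : zeroExt X ((0 : Ck p X E) : X → E) = 0 := zeroExt_zero X
  unfold Ck.deriv
  rw [h]
  simp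

theorem Ck.deriv_add (f g : Ck p X E) {j : ℕ} (hj : (j : ℕ∞) ≤ p) (x : X) :
    (f + g).deriv j x = f.deriv j x + g.deriv j x := by
  have h : zeroExt X ((f + g : Ck p X E) : X → E) = zeroExt X f + zeroExt X g :=
    zeroExt_add X f g
  unfold Ck.deriv
  rw [h]
  exact iteratedFDeriv_add_apply ((f.contDiffAt x).of_le (mod_cast hj))
    ((g.contDiffAt x).of_le (mod_cast hj))

theorem Ck.deriv_smul (c : ℝ) (f : Ck p X E) {j : ℕ} (hj : (j : ℕ∞) ≤ p) (x : X) :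
    (c • f).deriv j x = c • f.deriv j x := by
  have h : zeroExt X ((c • f : Ck p X E) : X → E) = c • zeroExt X f := zeroExt_smul X c f
  unfold Ck.deriv
  rw [h]
  exact iteratedFDeriv_const_smul_apply ((f.contDiffAt x).of_le (mod_cast hj))

theorem Ck.bddAbove_deriv (f : Ck p X E) (K : Compacts X) {k : ℕ} (hk : (k : ℕ∞) ≤ p) :
    BddAbove (range fun z : K × Fin (k + 1) => ‖f.deriv z.2 z.1‖) := by
  have hj : ∀ j : Fin (k + 1), ((j : ℕ) : ℕ∞) ≤ p := fun j =>
    le_trans (mod_cast Nat.lt_succ_iff.1 j.2) hk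
  have hc : Continuous fun z : K × Fin (k + 1) => ‖f.deriv z.2 z.1‖ := by
    refine continuous_prod_of_discrete_right.2 fun j => ?_
    exact ((f.continuous_deriv (hj j)).comp continuous_subtype_val).norm
  have : CompactSpace K := isCompact_iff_compactSpace.1 K.isCompact
  exact (isCompact_range hc).bddAbove

/-- The seminorm `ρ_{K,k}(f) = sup_{x ∈ K} sup_{0 ≤ j ≤ k} ‖D^j f(x)‖`, for `K ⊆ X` compact and
`k ≤ p`. -/
noncomputable def ckSeminorm (p : ℕ∞) (X : Opens G) (E : Type v) [NormedAddCommGroup E]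
    [NormedSpace ℝ E] (i : Compacts X × {k : ℕ // (k : ℕ∞) ≤ p}) : Seminorm ℝ (Ck p X E) :=
  Seminorm.ofSMulLE
    (fun f => ⨆ z : i.1 × Fin (i.2.1 + 1), ‖f.deriv z.2 z.1‖)
    (by simp [Ck.deriv_zero])
    (by
      intro f g
      refine Real.iSup_le (fun z => ?_)
        (add_nonneg (Real.iSup_nonneg fun _ => norm_nonneg _)
          (Real.iSup_nonneg fun _ => norm_nonneg _))
      have hz : ((z.2 : ℕ) : ℕ∞) ≤ p := le_trans (mod_cast Nat.lt_succ_iff.1 z.2.2) i.2.2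
      rw [Ck.deriv_add f g hz]
      exact (norm_add_le _ _).trans
        (add_le_add (le_ciSup (f.bddAbove_deriv i.1 i.2.2) z)
          (le_ciSup (g.bddAbove_deriv i.1 i.2.2) z)))
    (by
      intro c f
      refine Real.iSup_le (fun z => ?_)
        (mul_nonneg (norm_nonneg _) (Real.iSup_nonneg fun _ => norm_nonneg _))
      have hz : ((z.2 : ℕ) : ℕ∞) ≤ p := le_trans (mod_cast Nat.lt_succ_iff.1 z.2.2) i.2.2
      rw [Ck.deriv_smul c f hz, norm_smul]
      exact mul_le_mul_of_nonneg_left (le_ciSup (f.bddAbove_deriv i.1 i.2.2) z) (norm_nonneg _))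

instance : Nonempty (Compacts X × {k : ℕ // (k : ℕ∞) ≤ p}) := ⟨(⊥, ⟨0, by simp⟩)⟩

/-- The linear topology on `C^p(X, E)` generated by the seminorms `ρ_{K,k}`. -/
noncomputable instance : TopologicalSpace (Ck p X E) :=
  SeminormFamily.moduleFilterBasis (𝕜 := ℝ) (ckSeminorm p X E) |>.topology

/-- `S^k(G, E)`: the bounded symmetric `k`-linear maps from `G^k` to `E`. -/
def SymMul (k : ℕ) (G : Type u) (E : Type v) [NormedAddCommGroup G] [NormedSpace ℝ G]
    [NormedAddCommGroup E] [NormedSpace ℝ E] : Type (max u v) :=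
  {S : ContinuousMultilinearMap ℝ (fun _ : Fin k => G) E //
    ∀ (σ : Equiv.Perm (Fin k)) (v : Fin k → G), S (v ∘ σ) = S v}

/-- The function `x ↦ S((x - a)^k)` on `X`, for `S ∈ S^k(G, E)` and `a ∈ G`. -/
noncomputable def monomial (p : ℕ∞) (X : Opens G) {k : ℕ} (S : SymMul k G E) (a : G) :
    Ck p X E :=
  ⟨fun x : X => S.1 (fun _ => (x : G) - a), by
    have h : ContDiff ℝ p fun x : G => S.1 (fun _ : Fin k => x - a) :=
      S.1.contDiff.comp (contDiff_pi.2 fun _ => contDiff_id.sub contDiff_const)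
    exact h.contDiffOn.congr fun x hx => zeroExt_apply X _ ⟨x, hx⟩⟩

/-- There is a bump function `φ ∈ C^p(G)` with bounded derivatives up to order `p`, equal to `1` on
the ball of radius `1/2` and to `0` off the open unit ball. -/
def HasBump (p : ℕ∞) (G : Type u) [NormedAddCommGroup G] [NormedSpace ℝ G] : Prop :=
  ∃ φ : G → ℝ, ContDiff ℝ p φ ∧ (∀ x, ‖x‖ ≤ 1 / 2 → φ x = 1) ∧ (∀ x, 1 ≤ ‖x‖ → φ x = 0) ∧
    ∀ k : ℕ, (k : ℕ∞) ≤ p → ∃ C : ℝ, ∀ x, ‖iteratedFDeriv ℝ k φ x‖ ≤ C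

/-- The evaluation map from `X` to `ℝ_∞ ^ C^p(X)`, where `ℝ_∞` is the one-point compactification of
the real line. -/
noncomputable def evalMap (p : ℕ∞) (X : Opens G) (x : X) : Ck p X ℝ → OnePoint ℝ :=
  fun φ => ((φ x : ℝ) : OnePoint ℝ)

/-- The `C^p(X)`-compactification of `X`: the closure of the image of `X` in `ℝ_∞ ^ C^p(X)`. -/
abbrev Compactification (p : ℕ∞) (X : Opens G) : Type u :=
  ↥(closure (range (evalMap p X)))

/-- The canonical map from `X` to its compactification. -/
noncomputable def toCompactification (p : ℕ∞) (X : Opens G) (x : X) : Compactification p X :=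
  ⟨evalMap p X x, subset_closure (mem_range_self x)⟩

/-- The closure, in the compactification, of `{x ∈ X : f x ≠ 0}`. -/
def closedCarrier (f : Ck p X E) : Set (Compactification p X) :=
  closure (toCompactification p X '' {x | f x ≠ 0})

end Spaces

section Operators

universe w z

variable {G : Type u} [NormedAddCommGroup G] [NormedSpace ℝ G]
variable {E : Type v} [NormedAddCommGroup E] [NormedSpace ℝ E]
variable {H : Type w} [NormedAddCommGroup H] [NormedSpace ℝ H]
variable {F : Type z} [NormedAddCommGroup F] [NormedSpace ℝ F]
variable {p q : ℕ∞} {X : Opens G} {Y : Opens H}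

/-- `T` is separating (disjointness preserving). -/
def Separating (T : Ck p X E →ₗ[ℝ] Ck q Y F) : Prop :=
  ∀ f g : Ck p X E, (∀ x, f x = 0 ∨ g x = 0) → ∀ y, T f y = 0 ∨ T g y = 0

/-- `T` is nowhere trivial: no point of `Y` is a common zero of all the functions `T f`. -/
def NowhereTrivial (T : Ck p X E →ₗ[ℝ] Ck q Y F) : Prop :=
  ∀ y : Y, ∃ f : Ck p X E, T f y ≠ 0

/-- The intersection of the closures of all open subsets `U` of the compactification of `X` that
contain the closed carrier of some `f` with `T f y ≠ 0`. -/
def supportSet (T : Ck p X E →ₗ[ℝ] Ck q Y F) (y : Y) : Set (Compactification p X) :=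
  ⋂ U ∈ {U : Set (Compactification p X) |
    IsOpen U ∧ ∃ f : Ck p X E, T f y ≠ 0 ∧ closedCarrier f ⊆ U}, closure U

open Classical in
/-- The support map `h` of `T`: the set `supportSet T y` has exactly one point, that point lies in
the image of `X`, and `h y` is the corresponding point of `X`. (The value `0` is assigned where this
fails, which does not happen if `T` is continuous, separating and nowhere trivial and `G` has a bump
function.) -/
noncomputable def supportMap (T : Ck p X E →ₗ[ℝ] Ck q Y F) (y : Y) : G :=
  if hx : ∃ x : X, supportSet T y = {toCompactification p X x} then (hx.choose : G) else 0

/-- The coefficient `Φ_k(y, S)` of `D^k f(h y)` in the representation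
`T f (y) = ∑_{k ≤ p} Φ_k(y, D^k f(h y))`: the value of `T f / k!` at `y` for
`f(x) = S((x - h y)^k)`. -/
noncomputable def coeff (T : Ck p X E →ₗ[ℝ] Ck q Y F) (k : ℕ) (y : Y) (S : SymMul k G E) : F :=
  ((k.factorial : ℝ))⁻¹ • T (monomial p X S (supportMap T y)) y

end Operators

end SepOp

namespace SepOp

open Set Filter Topology TopologicalSpace

/-! ### Calculus in `C^p(X, E)`: germs, cutoffs and seminorms. -/

section Functions

variable {G : Type*} [NormedAddCommGroup G] [NormedSpace ℝ G]
variable {E : Type*} [NormedAddCommGroup E] [NormedSpace ℝ E]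
variable {p : ℕ∞} {X : Opens G}

/-! Let `m(x) = S((x - h y₀)^i)` with `T m y₀ ≠ 0`, and put `t = ‖h y - h y₀‖ > 0` for `y` near
`y₀`. Multiply `m` by a bump around `h y` of radius `t / 2`. The product `f` equals `m` near `h y`,
vanishes near `h y₀`, and has derivatives up to order `p` of size `O(t ^ i / t ^ p)`
(`exists_localized_monomial`). Since `T f y` depends only on the germ of `f` at `h y`, `T f y = T m
y` stays away from `0`, while `T f` vanishes near `y₀`. Taylor's estimate on the segment from `y₀`
to `y` (`norm_le_of_flat_of_segment`) and the continuity of `T` then give `‖T m y‖ ≤ C t ^ i / t ^ p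
* ‖y - y₀‖ ^ q'`, which is the claim. Continuity bounds derivatives of `T f` only over compact
subsets of `Y`, and balls need not be compact. So a failure of the claim is turned into a sequence
`u n → y₀`, whose segments to `y₀` do fill a compact set. The support map is handled through
`IsSupportPoint`: such points exist, coincide with `supportMap`, and vary continuously with `y`. -/

theorem Ck.sub_apply (f g : Ck p X E) (x : X) : (f - g) x = f x - g x := rfl

theorem Ck.ext {f g : Ck p X E} (h : ∀ x, f x = g x) : f = g := DFunLike.ext _ _ h

theorem Ck.norm_deriv_zero (f : Ck p X E) (x : X) : ‖f.deriv 0 x‖ = ‖f x‖ := by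
  rw [Ck.deriv, norm_iteratedFDeriv_zero, zeroExt_apply]

theorem Ck.continuous (f : Ck p X E) : Continuous f := by
  refine continuous_iff_continuousAt.2 fun x => ?_
  have h := (f.contDiffAt x).continuousAt.comp (continuous_subtype_val.continuousAt (x := x))
  refine h.congr (Eventually.of_forall fun z => zeroExt_apply X f z)

theorem Ck.eventually_zeroExt {f : Ck p X E} {x : X} {g : G → E}
    (h : ∀ᶠ z : X in 𝓝 x, f z = g z) : zeroExt X f =ᶠ[𝓝 (x : G)] g := by
  rw [← X.isOpen.isOpenEmbedding_subtypeVal.map_nhds_eq x]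
  refine Filter.eventually_map.2 (h.mono fun z hz => ?_)
  rw [← hz]
  exact zeroExt_apply X f z

theorem Ck.deriv_congr {f : Ck p X E} {x : X} {g : G → E}
    (h : ∀ᶠ z : X in 𝓝 x, f z = g z) (j : ℕ) : f.deriv j x = iteratedFDeriv ℝ j g x :=
  (Ck.eventually_zeroExt h).iteratedFDeriv ℝ j |>.eq_of_nhds

theorem Ck.deriv_eq_zero {f : Ck p X E} {x : X} (h : ∀ᶠ z : X in 𝓝 x, f z = 0) (j : ℕ) :
    f.deriv j x = 0 := by
  rw [Ck.deriv_congr (g := fun _ => 0) h]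
  simp

/-- The restriction to `X` of a `C^p` function on the whole space. -/
noncomputable def Ck.restrict (X : Opens G) (g : G → E) (hg : ContDiff ℝ p g) : Ck p X E :=
  ⟨fun x : X => g x, hg.contDiffOn.congr fun x hx => zeroExt_apply X _ ⟨x, hx⟩⟩

/-- The product of `f ∈ C^p(X, E)` with a scalar `C^p` function on the whole space. -/
noncomputable def Ck.mul (ψ : G → ℝ) (hψ : ContDiff ℝ p ψ) (f : Ck p X E) : Ck p X E :=
  ⟨fun x : X => ψ x • f x, (hψ.contDiffOn.smul f.2).congr fun x hx => by
    rw [zeroExt_apply X _ ⟨x, hx⟩]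
    exact congrArg (ψ x • ·) (zeroExt_apply X f ⟨x, hx⟩).symm⟩

theorem Ck.mul_apply (ψ : G → ℝ) (hψ : ContDiff ℝ p ψ) (f : Ck p X E) (x : X) :
    Ck.mul ψ hψ f x = ψ x • f x := rfl

theorem HasBump.exists_cutoff (h : HasBump p G) (a : G) {r : ℝ} (hr : 0 < r) :
    ∃ ψ : G → ℝ, ContDiff ℝ p ψ ∧ (∀ x, dist x a ≤ r / 2 → ψ x = 1) ∧
      ∀ x, r ≤ dist x a → ψ x = 0 := by
  obtain ⟨φ, hφ, h1, h0, -⟩ := h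
  have hn : ∀ x, ‖r⁻¹ • (x - a)‖ = dist x a / r := fun x => by
    rw [norm_smul, norm_inv, Real.norm_of_nonneg hr.le, dist_eq_norm, div_eq_inv_mul]
  refine ⟨fun x => φ (r⁻¹ • (x - a)),
    hφ.comp ((contDiff_id.sub contDiff_const).const_smul _), fun x hx => h1 _ ?_,
    fun x hx => h0 _ ?_⟩
  · rw [hn, div_le_iff₀ hr]; linarith
  · rw [hn, le_div_iff₀ hr]; linarith

theorem withSeminorms_ckSeminorm : WithSeminorms (ckSeminorm p X E) := ⟨rfl⟩

theorem ckSeminorm_le {i : Compacts X × {k : ℕ // (k : ℕ∞) ≤ p}} {f : Ck p X E} {M : ℝ}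
    (hM : 0 ≤ M) (h : ∀ x ∈ i.1, ∀ j ≤ i.2.1, ‖f.deriv j x‖ ≤ M) :
    ckSeminorm p X E i f ≤ M :=
  Real.iSup_le (fun z => h _ z.1.2 _ (Nat.lt_succ_iff.1 z.2.2)) hM

theorem le_ckSeminorm (i : Compacts X × {k : ℕ // (k : ℕ∞) ≤ p}) (f : Ck p X E) {x : X}
    (hx : x ∈ i.1) {j : ℕ} (hj : j ≤ i.2.1) : ‖f.deriv j x‖ ≤ ckSeminorm p X E i f :=
  le_ciSup (f := fun z : i.1 × Fin (i.2.1 + 1) => ‖f.deriv z.2 z.1‖)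
    (f.bddAbove_deriv i.1 i.2.2) (⟨x, hx⟩, ⟨j, Nat.lt_succ_iff.2 hj⟩)

/-! ### Derivative estimates for localized monomials and for flat functions. -/

/-- The diagonal values of a multilinear map have homogeneous derivative bounds. -/
theorem norm_iteratedFDeriv_diagonal_le {i : ℕ}
    (S : ContinuousMultilinearMap ℝ (fun _ : Fin i => G) E) (j : ℕ) (x a : G) :
    ‖iteratedFDeriv ℝ j (fun x => S fun _ => x - a) x‖ ≤
      i.descFactorial j * ‖S‖ * ‖x - a‖ ^ (i - j) := by
  let Δ : G →L[ℝ] (Fin i → G) := ContinuousLinearMap.pi fun _ => ContinuousLinearMap.id ℝ G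
  have hΔ : ‖Δ‖ ≤ 1 := ContinuousLinearMap.opNorm_le_bound _ zero_le_one fun x => by
    rw [one_mul]
    exact (pi_norm_le_iff_of_nonneg (norm_nonneg x)).2 fun _ => le_rfl
  have e : iteratedFDeriv ℝ j (fun x => S fun _ => x - a) x =
      iteratedFDeriv ℝ j (S ∘ Δ) (x - a) :=
    iteratedFDeriv_comp_sub (f := S ∘ Δ) j a x
  rw [e, Δ.iteratedFDeriv_comp_right (n := j) S.contDiff _ le_rfl]
  refine (ContinuousMultilinearMap.norm_compContinuousLinearMap_le _ _).trans ?_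
  have h1 : ∏ _ : Fin j, ‖Δ‖ ≤ 1 := Finset.prod_le_one (fun _ _ => norm_nonneg _) fun _ _ => hΔ
  refine (mul_le_of_le_one_right (norm_nonneg _) h1).trans ?_
  refine (S.norm_iteratedFDeriv_le j (Δ (x - a))).trans ?_
  rw [Fintype.card_fin]
  gcongr
  exact (Δ.le_of_opNorm_le hΔ _).trans_eq (one_mul _)

/-- Writing the scale as `t ^ i * (t ^ j)⁻¹` covers all `j` at once: for `j > i` the factor
`descFactorial` is zero. -/
theorem norm_iteratedFDeriv_diagonal_le_of_le {i : ℕ}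
    (S : ContinuousMultilinearMap ℝ (fun _ : Fin i => G) E) (j : ℕ) {x a : G} {t : ℝ}
    (ht : 0 < t) (hx : ‖x - a‖ ≤ 2 * t) :
    ‖iteratedFDeriv ℝ j (fun x => S fun _ => x - a) x‖ ≤
      (i.descFactorial j * ‖S‖ * 2 ^ (i - j)) * (t ^ i * (t ^ j)⁻¹) := by
  refine (norm_iteratedFDeriv_diagonal_le S j x a).trans ?_
  rcases le_or_gt j i with hj | hj
  · rw [← pow_sub₀ t ht.ne' hj, mul_assoc _ (2 ^ (i - j)), ← mul_pow]
    gcongr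
  · simp [Nat.descFactorial_eq_zero_iff_lt.2 hj]

theorem norm_iteratedFDeriv_rescale {φ : G → ℝ} {j : ℕ} (hφ : ContDiff ℝ j φ) {C : ℝ}
    (hC : ∀ x, ‖iteratedFDeriv ℝ j φ x‖ ≤ C) (c : ℝ) (a x : G) :
    ‖iteratedFDeriv ℝ j (fun x => φ (c • (x - a))) x‖ ≤ |c| ^ j * C := by
  have e : iteratedFDeriv ℝ j (fun x => φ (c • (x - a))) x =
      iteratedFDeriv ℝ j (fun x => φ (c • x)) (x - a) :=
    iteratedFDeriv_comp_sub (f := fun x => φ (c • x)) j a x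
  rw [e, iteratedFDeriv_comp_const_smul c hφ, norm_smul, norm_pow, Real.norm_eq_abs]
  gcongr
  exact hC _

/-- Cutting the monomial `S((x - b)^i)` off at scale `‖a - b‖` around `a`. -/
theorem HasBump.exists_localized_monomial {p : ℕ} (h : HasBump (p : ℕ∞) G) {i : ℕ}
    (S : ContinuousMultilinearMap ℝ (fun _ : Fin i => G) E) :
    ∃ M : ℝ, 0 ≤ M ∧ ∀ a b : G, a ≠ b → ‖a - b‖ ≤ 1 →
      ∃ ψ : G → ℝ, ContDiff ℝ p ψ ∧ (∀ᶠ x in 𝓝 a, ψ x = 1) ∧ (∀ᶠ x in 𝓝 b, ψ x = 0) ∧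
        ∀ j ≤ p, ∀ x, ‖iteratedFDeriv ℝ j (fun x => ψ x • S fun _ => x - b) x‖ ≤
          M * (‖a - b‖ ^ i * (‖a - b‖ ^ p)⁻¹) := by
  obtain ⟨φ, hφ, h1, h0, hb⟩ := h
  have hb' : ∀ k : ℕ, ∃ C : ℝ, 0 ≤ C ∧ (k ≤ p → ∀ x, ‖iteratedFDeriv ℝ k φ x‖ ≤ C) := by
    intro k
    by_cases hk : k ≤ p
    · obtain ⟨C, hC⟩ := hb k (mod_cast hk)
      exact ⟨C, (norm_nonneg _).trans (hC 0), fun _ => hC⟩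
    · exact ⟨0, le_rfl, fun h => absurd h hk⟩
  choose C hC0 hC using hb'
  let A : ℕ → ℝ := fun j => i.descFactorial j * ‖S‖ * 2 ^ (i - j)
  have hA : ∀ j, 0 ≤ A j := fun j => by positivity
  -- The Leibniz constant: `2 ^ k * C k` comes from the bump rescaled by `2 / t`, `A` from the
  -- monomial on the ball of radius `2 * t` around `b`.
  let N : ℕ → ℝ := fun j => ∑ k ∈ Finset.range (j + 1), (j.choose k : ℝ) * (2 ^ k * C k) * A (j - k)
  have hN : ∀ j, 0 ≤ N j := fun j => Finset.sum_nonneg fun k _ =>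
    mul_nonneg (mul_nonneg (by positivity) (mul_nonneg (by positivity) (hC0 k))) (hA _)
  refine ⟨∑ j ∈ Finset.range (p + 1), N j, Finset.sum_nonneg fun j _ => hN j, ?_⟩
  intro a b hab hle
  have ht : 0 < ‖a - b‖ := norm_pos_iff.2 (sub_ne_zero.2 hab)
  set t := ‖a - b‖ with htdef
  have hnorm : ∀ x, ‖(2 / t) • (x - a)‖ = 2 * ‖x - a‖ / t := fun x => by
    rw [norm_smul, Real.norm_of_nonneg (by positivity)]; ring
  have hcont : Continuous fun x : G => ‖(2 / t) • (x - a)‖ := by fun_prop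
  -- The bump lives in the ball of radius `t / 2` around `a`, which misses `b` and everything
  -- farther than `2 * t` from `b`. Strict inequality makes the vanishing hold on a neighbourhood.
  have hfar : ∀ x, 2 * t < ‖x - b‖ ∨ x = b → 1 < ‖(2 / t) • (x - a)‖ := by
    intro x hx
    rw [hnorm, lt_div_iff₀ ht, one_mul]
    rcases hx with hx | rfl
    · have := norm_sub_le_norm_sub_add_norm_sub x a b
      rw [← htdef] at this
      linarith
    · rw [norm_sub_rev x a, ← htdef]; linarith
  have hvan : ∀ x, 1 < ‖(2 / t) • (x - a)‖ → ∀ᶠ z in 𝓝 x, φ ((2 / t) • (z - a)) = 0 := fun x hx =>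
    (hcont.continuousAt.eventually (lt_mem_nhds hx)).mono fun z hz => h0 _ hz.le
  have hψ : ContDiff ℝ p fun x => φ ((2 / t) • (x - a)) :=
    hφ.comp ((contDiff_id.sub contDiff_const).const_smul _)
  refine ⟨fun x => φ ((2 / t) • (x - a)), hψ, ?_, hvan b (hfar b (Or.inr rfl)), ?_⟩
  · have : ‖(2 / t) • (a - a)‖ < 1 / 2 := by simp
    exact (hcont.continuousAt.eventually (gt_mem_nhds this)).mono fun z hz => h1 _ hz.le
  · intro j hj x
    have hMj : N j ≤ ∑ j ∈ Finset.range (p + 1), N j :=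
      Finset.single_le_sum (fun j _ => hN j) (Finset.mem_range.2 (Nat.lt_succ_iff.2 hj))
    rcases lt_or_ge (2 * t) ‖x - b‖ with hx | hx
    · have e : (fun x => φ ((2 / t) • (x - a)) • S fun _ => x - b) =ᶠ[𝓝 x] fun _ => 0 :=
        (hvan x (hfar x (Or.inl hx))).mono fun z hz => by simp only [hz, zero_smul]
      rw [(e.iteratedFDeriv ℝ j).eq_of_nhds]
      have := (hN j).trans hMj
      simp only [iteratedFDeriv_fun_zero, Pi.zero_apply, norm_zero]
      positivity
    · have hS : ContDiff ℝ p fun x : G => S fun _ => x - b :=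
        S.contDiff.comp (contDiff_pi.2 fun _ => contDiff_id.sub contDiff_const)
      refine (norm_iteratedFDeriv_smul_le hψ hS x (mod_cast hj)).trans ?_
      calc _ ≤ ∑ k ∈ Finset.range (j + 1), (j.choose k : ℝ) * ((2 / t) ^ k * C k) *
              (A (j - k) * (t ^ i * (t ^ (j - k))⁻¹)) := by
            refine Finset.sum_le_sum fun k hk => ?_
            have hkj : k ≤ j := Nat.lt_succ_iff.1 (Finset.mem_range.1 hk)
            have h1 := norm_iteratedFDeriv_rescale (hφ.of_le (mod_cast hkj.trans hj))
              (hC k (hkj.trans hj)) (2 / t) a x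
            rw [abs_of_pos (by positivity)] at h1
            have h2 := norm_iteratedFDeriv_diagonal_le_of_le S (j - k) ht hx
            have := hC0 k
            gcongr
        _ = N j * (t ^ i * (t ^ j)⁻¹) := by
            rw [Finset.sum_mul]
            refine Finset.sum_congr rfl fun k hk => ?_
            have hkj : k ≤ j := Nat.lt_succ_iff.1 (Finset.mem_range.1 hk)
            have : t ^ j = t ^ k * t ^ (j - k) := by rw [← pow_add, Nat.add_sub_cancel' hkj]
            rw [this, div_pow]
            field_simp
        _ ≤ _ := by
            -- Here `t ≤ 1` makes order `p` the worst one.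
            have h3 : (t ^ j)⁻¹ ≤ (t ^ p)⁻¹ :=
              inv_anti₀ (by positivity) (pow_le_pow_of_le_one ht.le hle hj)
            have := (hN j).trans hMj
            gcongr

/-- A function which is flat at `a` is controlled on a segment issuing from `a` by a bound for its
derivative of order `k`. -/
theorem norm_le_of_flat_of_segment {f : G → E} {k : ℕ} {a b : G} {M : ℝ}
    (hf : ∀ z ∈ segment ℝ a b, ContDiffAt ℝ k f z)
    (h0 : ∀ j ≤ k, iteratedFDeriv ℝ j f a = 0)
    (hM : ∀ z ∈ segment ℝ a b, ‖iteratedFDeriv ℝ k f z‖ ≤ M) :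
    ‖f b‖ ≤ M * ‖b - a‖ ^ k := by
  -- Descend from order `k` to order `0`; each application of the mean value inequality gains one
  -- factor `‖b - a‖`.
  have key : ∀ m ≤ k, ∀ z ∈ segment ℝ a b,
      ‖iteratedFDeriv ℝ (k - m) f z‖ ≤ M * ‖b - a‖ ^ m := by
    intro m
    induction m with
    | zero => intro _ z hz; simpa using hM z hz
    | succ m ih =>
      intro hm z hz
      have hM0 : 0 ≤ M * ‖b - a‖ ^ m :=
        (norm_nonneg _).trans (ih (by omega) a (left_mem_segment ℝ a b))
      have e : k - m = (k - (m + 1)) + 1 := by omega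
      have hd : ∀ w ∈ segment ℝ a b, HasFDerivWithinAt (iteratedFDeriv ℝ (k - (m + 1)) f)
          (fderiv ℝ (iteratedFDeriv ℝ (k - (m + 1)) f) w) (segment ℝ a b) w := fun w hw =>
        ((hf w hw).differentiableAt_iteratedFDeriv
          (mod_cast (by omega : k - (m + 1) < k))).hasFDerivAt.hasFDerivWithinAt
      have hbd : ∀ w ∈ segment ℝ a b,
          ‖fderiv ℝ (iteratedFDeriv ℝ (k - (m + 1)) f) w‖ ≤ M * ‖b - a‖ ^ m := fun w hw => by
        rw [norm_fderiv_iteratedFDeriv, ← e]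
        exact ih (by omega) w hw
      have := (convex_segment a b).norm_image_sub_le_of_norm_hasFDerivWithin_le hd hbd
        (left_mem_segment ℝ a b) hz
      rw [h0 _ (by omega), sub_zero] at this
      refine this.trans ?_
      rw [pow_succ, ← mul_assoc]
      gcongr
      exact norm_sub_le_of_mem_segment hz
  have h := key k le_rfl b (right_mem_segment ℝ a b)
  rwa [Nat.sub_self, norm_iteratedFDeriv_zero] at h

end Functions

/-! ### Continuity of `T` in terms of derivative bounds. -/

section Operators

variable {G : Type*} [NormedAddCommGroup G] [NormedSpace ℝ G]
variable {E : Type*} [NormedAddCommGroup E] [NormedSpace ℝ E]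
variable {H : Type*} [NormedAddCommGroup H] [NormedSpace ℝ H]
variable {F : Type*} [NormedAddCommGroup F] [NormedSpace ℝ F]
variable {p q : ℕ∞} {X : Opens G} {Y : Opens H}

/-- Continuity bounds one seminorm of `T f` by finitely many of `f`; the union of their compact sets
serves as `K`, and all their orders are at most the finite `p`. -/
theorem exists_deriv_bound_of_continuous {p : ℕ} (T : Ck (p : ℕ∞) X E →ₗ[ℝ] Ck q Y F)
    (hT : Continuous T) (L : Compacts Y) {k : ℕ} (hk : (k : ℕ∞) ≤ q) :
    ∃ (K : Compacts X) (C : ℝ), 0 ≤ C ∧ ∀ (f : Ck (p : ℕ∞) X E) (M : ℝ), 0 ≤ M →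
      (∀ x ∈ K, ∀ j ≤ p, ‖f.deriv j x‖ ≤ M) → ∀ y ∈ L, ∀ j ≤ k, ‖(T f).deriv j y‖ ≤ C * M := by
  have hc : Continuous ((ckSeminorm q Y F (L, ⟨k, hk⟩)).comp T) :=
    (withSeminorms_ckSeminorm.continuous_seminorm (L, ⟨k, hk⟩)).comp hT
  obtain ⟨s, C, -, hC⟩ := Seminorm.bound_of_continuous withSeminorms_ckSeminorm _ hc
  refine ⟨s.sup Prod.fst, C, C.2, fun f M hM hf y hy j hj => ?_⟩
  refine (le_ckSeminorm (L, ⟨k, hk⟩) (T f) hy hj).trans ((hC f).trans ?_)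
  refine mul_le_mul_of_nonneg_left (Seminorm.finset_sup_apply_le hM fun i hi => ?_) C.2
  exact ckSeminorm_le hM fun x hx j hj => hf x
    (SetLike.coe_subset_coe.2 (Finset.le_sup (f := Prod.fst) hi) hx) j
    (hj.trans (mod_cast i.2.2))

theorem Separating.apply_eq_zero {T : Ck p X E →ₗ[ℝ] Ck q Y F} (hsep : Separating T)
    {f g : Ck p X E} (hfg : ∀ x, f x = 0 ∨ g x = 0) {y : Y} (hf : T f y ≠ 0) : T g y = 0 :=
  (hsep f g hfg y).resolve_left hf

/-! ### Support points and the support map. -/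

/-- `T f y` can be nonzero for functions `f` supported arbitrarily close to `x`. -/
def IsSupportPoint (T : Ck p X E →ₗ[ℝ] Ck q Y F) (y : Y) (x : X) : Prop :=
  ∀ r : ℝ, 0 < r → ∃ f : Ck p X E, (∀ z : X, r ≤ dist z x → f z = 0) ∧ T f y ≠ 0

/-- If `x` is not a support point, some cutoff `1 - ψ` vanishes near `x` and multiplication by it
does not change `T g y`. By compactness a finite product of these vanishes near all of `K`, where
continuity forces `T` to give `0` at `y`; so `T` would be trivial at `y`. -/
theorem exists_isSupportPoint {p : ℕ} (hbump : HasBump (p : ℕ∞) G)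
    {T : Ck (p : ℕ∞) X E →ₗ[ℝ] Ck q Y F} (hT : Continuous T) (hnt : NowhereTrivial T) (y : Y) :
    ∃ x, IsSupportPoint T y x := by
  obtain ⟨K, C, -, hK⟩ := exists_deriv_bound_of_continuous T hT ⟨{y}, isCompact_singleton⟩
    (k := 0) (by simp)
  have hvan : ∀ f : Ck (p : ℕ∞) X E, (∀ x ∈ K, ∀ᶠ z in 𝓝 x, f z = 0) → T f y = 0 := by
    intro f hf
    have h := hK f 0 le_rfl (fun x hx j _ => by rw [Ck.deriv_eq_zero (hf x hx), norm_zero]) y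
      (mem_singleton y) 0 le_rfl
    rw [Ck.norm_deriv_zero, mul_zero] at h
    exact norm_le_zero_iff.1 h
  by_contra! hcon
  -- Multiplying the cutoffs makes `P` stable under unions, as induction over a compact set
  -- requires.
  let P : Set X → Prop := fun s => ∃ (ψ : G → ℝ) (hψ : ContDiff ℝ (p : ℕ∞) ψ),
    (∀ x ∈ s, ∀ᶠ z : X in 𝓝 x, ψ z = 0) ∧ ∀ g : Ck (p : ℕ∞) X E, T (Ck.mul ψ hψ g) y = T g y
  have hP : P K := by
    refine K.isCompact.induction_on (p := P) ⟨fun _ => 1, contDiff_const, by simp, fun g => ?_⟩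
      ?_ ?_ ?_
    · congr 2
      exact Ck.ext fun x => one_smul ℝ (g x)
    · rintro s t hst ⟨ψ, hψ, h1, h2⟩
      exact ⟨ψ, hψ, fun x hx => h1 x (hst hx), h2⟩
    · rintro s t ⟨ψ, hψ, h1, h2⟩ ⟨χ, hχ, h3, h4⟩
      refine ⟨fun x => ψ x * χ x, hψ.mul hχ, ?_, fun g => ?_⟩
      · rintro x (hx | hx)
        · exact (h1 x hx).mono fun z hz => mul_eq_zero_of_left hz _
        · exact (h3 x hx).mono fun z hz => mul_eq_zero_of_right _ hz
      · have e : Ck.mul (fun x => ψ x * χ x) (hψ.mul hχ) g = Ck.mul ψ hψ (Ck.mul χ hχ g) :=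
          Ck.ext fun x => mul_smul (ψ x) (χ x) (g x)
        rw [e, h2, h4]
    · intro x _
      have hx := hcon x
      unfold IsSupportPoint at hx
      push Not at hx
      obtain ⟨r, hr, hx⟩ := hx
      obtain ⟨ψ, hψ, h1, h0⟩ := hbump.exists_cutoff (x : G) hr
      refine ⟨Metric.ball x (r / 2),
        mem_nhdsWithin_of_mem_nhds (Metric.ball_mem_nhds x (half_pos hr)),
        fun z => 1 - ψ z, contDiff_const.sub hψ, fun z hz => ?_, fun g => ?_⟩
      · filter_upwards [Metric.isOpen_ball.mem_nhds hz] with w hw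
        rw [h1 w (le_of_lt hw), sub_self]
      · have h := hx (Ck.mul ψ hψ g) fun z hz => by
          rw [Ck.mul_apply, h0 z hz, zero_smul]
        have e : Ck.mul (fun z => 1 - ψ z) (contDiff_const.sub hψ) g = g - Ck.mul ψ hψ g :=
          Ck.ext fun z => by
            rw [Ck.sub_apply, Ck.mul_apply, Ck.mul_apply, sub_smul, one_smul]
        rw [e, map_sub, Ck.sub_apply, h, sub_zero]
  obtain ⟨ψ, hψ, h1, h2⟩ := hP
  obtain ⟨f, hf⟩ := hnt y
  refine hf ?_
  rw [← h2 f]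
  exact hvan _ fun x hx => (h1 x hx).mono fun z hz => by rw [Ck.mul_apply, hz, zero_smul]

namespace IsSupportPoint

variable {T : Ck p X E →ₗ[ℝ] Ck q Y F} {y : Y} {x : X}

/-- A test function supported close enough to `x` is disjoint from `g` but not killed at `y`, so
separation kills `T g y`. -/
theorem apply_eq_zero (h : IsSupportPoint T y x) (hsep : Separating T) {g : Ck p X E}
    (hg : ∀ᶠ z in 𝓝 x, g z = 0) : T g y = 0 := by
  obtain ⟨r, hr, hg⟩ := Metric.eventually_nhds_iff.1 hg
  obtain ⟨f, hf, hfy⟩ := h r hr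
  refine hsep.apply_eq_zero (fun z => ?_) hfy
  rcases le_or_gt r (dist z x) with hz | hz
  · exact Or.inl (hf z hz)
  · exact Or.inr (hg hz)

theorem apply_congr (h : IsSupportPoint T y x) (hsep : Separating T) {f g : Ck p X E}
    (hfg : ∀ᶠ z in 𝓝 x, f z = g z) : T f y = T g y := by
  have := h.apply_eq_zero hsep (g := f - g)
    (hfg.mono fun z hz => by rw [Ck.sub_apply, hz, sub_self])
  rwa [map_sub, Ck.sub_apply, sub_eq_zero] at this

theorem supportSet_eq (h : IsSupportPoint T y x) (hsep : Separating T) :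
    supportSet T y = {toCompactification p X x} := by
  have hcont : Continuous (toCompactification p X) :=
    (continuous_pi fun ψ => OnePoint.continuous_coe.comp ψ.continuous).subtype_mk _
  refine Subset.antisymm (fun z hz => ?_) (singleton_subset_iff.2 ?_)
  · by_contra hne
    have hex : ∃ ψ, z.1 ψ ≠ evalMap p X x ψ := by
      by_contra! hall
      exact hne (Subtype.ext (funext hall))
    obtain ⟨ψ, hψ⟩ := hex
    obtain ⟨W, V, hW, hV, hzW, hxV, hWV⟩ := t2_separation hψ
    -- The closed neighbourhood `V'` keeps the closure of the carrier inside `V`.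
    obtain ⟨V', hV', hxV', hVV'⟩ := exists_mem_nhds_isClosed_subset (hV.mem_nhds hxV)
    have hco : Continuous fun w : Compactification p X => w.1 ψ :=
      (continuous_apply ψ).comp continuous_subtype_val
    have hnear : ∀ᶠ w in 𝓝 x, evalMap p X w ψ ∈ V' :=
      (hco.comp hcont).continuousAt.eventually (hV' : V' ∈ 𝓝 (evalMap p X x ψ))
    obtain ⟨r, hr, hball⟩ := Metric.eventually_nhds_iff.1 hnear
    obtain ⟨f, hf, hfy⟩ := h r hr
    have hsub : closedCarrier f ⊆ (fun w : Compactification p X => w.1 ψ) ⁻¹' V := by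
      refine (closure_minimal ?_ (hxV'.preimage hco)).trans (preimage_mono hVV')
      rintro _ ⟨w, hw, rfl⟩
      refine hball (lt_of_not_ge fun hle => hw (hf w hle))
    have hz' := mem_iInter₂.1 hz _ ⟨hV.preimage hco, f, hfy, hsub⟩
    obtain ⟨w, hw1, hw2⟩ := mem_closure_iff.1 hz' _ (hW.preimage hco) hzW
    exact hWV.le_bot ⟨hw1, hw2⟩
  · refine mem_iInter₂.2 fun U hU => ?_
    obtain ⟨-, f, hf, hfU⟩ := hU
    refine subset_closure (hfU ?_)
    have hx : x ∈ closure {x | f x ≠ 0} := by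
      rw [mem_closure_iff_frequently]
      exact fun hev => hf (h.apply_eq_zero hsep (hev.mono fun z hz => not_not.1 hz))
    exact image_closure_subset_closure_image hcont (mem_image_of_mem _ hx)

theorem supportMap_eq (h : IsSupportPoint T y x) (hsep : Separating T) :
    supportMap T y = x := by
  have hex : ∃ x : X, supportSet T y = {toCompactification p X x} := ⟨x, h.supportSet_eq hsep⟩
  rw [supportMap, dif_pos hex]
  have he := singleton_injective ((h.supportSet_eq hsep).symm.trans hex.choose_spec)
  by_contra hne
  -- Continuous linear functionals are coordinates of the compactification, so they separate the
  -- points of `X` there.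
  obtain ⟨l, hl⟩ := SeparatingDual.exists_ne_zero (R := ℝ) (sub_ne_zero.2 hne)
  have := congrFun (congrArg Subtype.val he) (Ck.restrict X l l.contDiff)
  have hval : l (x : G) = l (hex.choose : G) := OnePoint.coe_injective this
  rw [map_sub, sub_ne_zero] at hl
  exact hl hval.symm

end IsSupportPoint

/-- Cut `f` with `T f y ≠ 0` off near `h y`. Its image is still nonzero at nearby `y'`, so `h y'`
cannot leave the support of the cutoff. -/
theorem continuous_of_isSupportPoint (hbump : HasBump p G) {T : Ck p X E →ₗ[ℝ] Ck q Y F}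
    (hsep : Separating T) (hnt : NowhereTrivial T) {h : Y → X}
    (hh : ∀ y, IsSupportPoint T y (h y)) : Continuous h := by
  refine continuous_iff_continuousAt.2 fun y => Metric.tendsto_nhds.2 fun ε hε => ?_
  obtain ⟨f, hf⟩ := hnt y
  obtain ⟨ψ, hψ, h1, h0⟩ := hbump.exists_cutoff (h y : G) (half_pos hε)
  have hne : T (Ck.mul ψ hψ f) y ≠ 0 := by
    rwa [(hh y).apply_congr hsep (g := f)]
    filter_upwards [Metric.ball_mem_nhds (h y) (half_pos (half_pos hε))] with z hz
    rw [Ck.mul_apply, h1 z (le_of_lt hz), one_smul]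
  filter_upwards [(T (Ck.mul ψ hψ f)).continuous.continuousAt.eventually_ne hne] with y' hy'
  by_contra hle
  refine hy' ((hh y').apply_eq_zero hsep ?_)
  have hlt : ε / 2 < dist (h y') (h y) := (half_lt_self hε).trans_le (not_lt.1 hle)
  have hd : Continuous fun z : X => dist z (h y) := by fun_prop
  filter_upwards [hd.continuousAt.eventually (lt_mem_nhds hlt)] with z hz
  rw [Ck.mul_apply, h0 z hz.le, zero_smul]

/-! ### The estimate along a sequence. -/

/-- The closed segments that join the points of a sequence to its limit form a compact set. -/
theorem isCompact_iUnion_segment {u : ℕ → H} {a : H} (hu : Tendsto u atTop (𝓝 a)) :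
    ∃ L : Set H, IsCompact L ∧ (∀ n, segment ℝ a (u n) ⊆ L) ∧
      ∀ z ∈ L, ∃ b ∈ insert a (range u), z ∈ segment ℝ a b := by
  refine ⟨(fun w : H × ℝ => a + w.2 • (w.1 - a)) '' (insert a (range u) ×ˢ Icc 0 1),
    (hu.isCompact_insert_range.prod isCompact_Icc).image (by fun_prop), fun n => ?_, ?_⟩
  · rw [segment_eq_image']
    rintro _ ⟨θ, hθ, rfl⟩
    exact ⟨(u n, θ), ⟨Or.inr (mem_range_self n), hθ⟩, rfl⟩
  · rintro _ ⟨⟨b, θ⟩, ⟨hb, hθ⟩, rfl⟩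
    refine ⟨b, hb, ?_⟩
    rw [segment_eq_image']
    exact ⟨θ, hθ, rfl⟩

theorem exists_uniform_bound_of_isSupportPoint {p : ℕ} (hbump : HasBump (p : ℕ∞) G)
    {T : Ck (p : ℕ∞) X E →ₗ[ℝ] Ck q Y F} (hT : Continuous T)
    (hsep : Separating T) (hnt : NowhereTrivial T) {h : Y → X}
    (hh : ∀ y, IsSupportPoint T y (h y)) {y₀ : Y} {i : ℕ} (hi : i ≤ p) (S : SymMul i G E)
    (hS : T (monomial p X S (h y₀ : G)) y₀ ≠ 0) {k : ℕ} (hk : (k : ℕ∞) ≤ q)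
    {r : ℝ} (hrY : Metric.ball (y₀ : H) r ⊆ Y)
    {u : ℕ → Y} (hu : ∀ n, (u n : H) ∈ Metric.ball (y₀ : H) r) (hlim : Tendsto u atTop (𝓝 y₀)) :
    ∃ C : ℝ, ∀ᶠ n in atTop, h (u n) ≠ h y₀ →
      ‖(h (u n) : G) - h y₀‖ ^ (p - i) ≤ C * ‖(u n : H) - y₀‖ ^ k := by
  have hlim' : Tendsto (fun n => (u n : H)) atTop (𝓝 (y₀ : H)) :=
    continuous_subtype_val.continuousAt.tendsto.comp hlim
  have hcont := continuous_of_isSupportPoint hbump hsep hnt hh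
  have hr : 0 < r := Metric.pos_of_mem_ball (hu 0)
  obtain ⟨L, hL, hsegL, hLseg⟩ := isCompact_iUnion_segment hlim'
  have hLY : L ⊆ Y := by
    intro z hz
    obtain ⟨b, hb, hzb⟩ := hLseg z hz
    refine hrY ((convex_ball (y₀ : H) r).segment_subset (Metric.mem_ball_self hr) ?_ hzb)
    rcases hb with rfl | ⟨n, rfl⟩
    · exact Metric.mem_ball_self hr
    · exact hu n
  let L' : Compacts Y := ⟨(↑) ⁻¹' L, by
    rw [Subtype.isCompact_iff, image_preimage_eq_of_subset fun z hz => ⟨⟨z, hLY hz⟩, rfl⟩]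
    exact hL⟩
  obtain ⟨K, C, hC, hK⟩ := exists_deriv_bound_of_continuous T hT L' hk
  obtain ⟨M, hM, hloc⟩ := hbump.exists_localized_monomial S.1
  set m := monomial (p : ℕ∞) X S (h y₀ : G) with hm
  have hc : 0 < ‖T m y₀‖ := norm_pos_iff.2 hS
  -- `‖T m y₀‖ / 2` is a lower bound for `‖T m (u n)‖` for large `n`.
  refine ⟨(‖T m y₀‖ / 2)⁻¹ * (C * M), ?_⟩
  have hev1 : ∀ᶠ n in atTop, ‖T m y₀‖ / 2 < ‖T m (u n)‖ :=
    ((T m).continuous.norm.continuousAt.tendsto.comp hlim).eventually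
      (lt_mem_nhds (half_lt_self hc))
  have hev2 : ∀ᶠ n in atTop, dist (h (u n)) (h y₀) < 1 :=
    (hcont.continuousAt.tendsto.comp hlim).eventually (Metric.ball_mem_nhds _ one_pos)
  filter_upwards [hev1, hev2] with n h1 h2 hne
  obtain ⟨ψ, hψ, hψ1, hψ0, hψM⟩ := hloc (h (u n)) (h y₀) (Subtype.coe_injective.ne hne)
    (by rw [← dist_eq_norm]; exact h2.le)
  set t := ‖(h (u n) : G) - h y₀‖ with ht
  have ht0 : 0 < t := norm_pos_iff.2 (sub_ne_zero.2 (Subtype.coe_injective.ne hne))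
  set f := Ck.mul ψ hψ m with hf
  have hfm : T f (u n) = T m (u n) := by
    refine (hh (u n)).apply_congr hsep ?_
    filter_upwards [continuous_subtype_val.continuousAt.eventually hψ1] with z hz
    rw [hf, Ck.mul_apply, hz, one_smul]
  have hflat : ∀ᶠ y in 𝓝 y₀, T f y = 0 := by
    have : ∀ᶠ z in 𝓝 (h y₀), ∀ᶠ w in 𝓝 z, f w = 0 := by
      refine Eventually.eventually_nhds ?_
      filter_upwards [continuous_subtype_val.continuousAt.eventually hψ0] with z hz
      rw [hf, Ck.mul_apply, hz, zero_smul]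
    filter_upwards [hcont.continuousAt.eventually this] with y hy
    exact (hh y).apply_eq_zero hsep hy
  set B := M * (t ^ i * (t ^ p)⁻¹) with hB
  have hB0 : 0 ≤ B := by positivity
  -- The bound on `f` holds on the whole space, so it does not matter where `K` lies.
  have hbd := hK f B hB0 fun x _ j hj => by
    rw [Ck.deriv_congr (g := fun x => ψ x • S.1 fun _ => x - h y₀)
      (Eventually.of_forall fun z => rfl)]
    exact hψM j hj x
  have hest : ‖zeroExt Y (T f) (u n)‖ ≤ C * B * ‖(u n : H) - y₀‖ ^ k := by
    refine norm_le_of_flat_of_segment (a := (y₀ : H)) (fun z hz => ?_) (fun j _ => ?_)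
      fun z hz => ?_
    · exact ((T f).contDiffAt ⟨z, hLY (hsegL n hz)⟩).of_le (mod_cast hk)
    · exact Ck.deriv_eq_zero hflat j
    · exact hbd ⟨z, hLY (hsegL n hz)⟩ (hsegL n hz) k le_rfl
  rw [zeroExt_apply, hfm] at hest
  have hpow : t ^ (p - i) * (t ^ i * (t ^ p)⁻¹) = 1 := by
    rw [← mul_assoc, pow_sub_mul_pow t hi, mul_inv_cancel₀ (by positivity)]
  calc t ^ (p - i) = (‖T m y₀‖ / 2)⁻¹ * (t ^ (p - i) * (‖T m y₀‖ / 2)) := by field_simp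
    _ ≤ (‖T m y₀‖ / 2)⁻¹ * (t ^ (p - i) * (C * B * ‖(u n : H) - y₀‖ ^ k)) := by
        gcongr
        exact h1.le.trans hest
    _ = (‖T m y₀‖ / 2)⁻¹ * (C * M) * ‖(u n : H) - y₀‖ ^ k *
          (t ^ (p - i) * (t ^ i * (t ^ p)⁻¹)) := by rw [hB]; ring
    _ = _ := by rw [hpow, mul_one]

end Operators

end SepOp

theorem theorem12
    {G E H F : Type*}
    [NormedAddCommGroup G] [NormedSpace ℝ G] [CompleteSpace G]
    [NormedAddCommGroup E] [NormedSpace ℝ E] [CompleteSpace E]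
    [NormedAddCommGroup H] [NormedSpace ℝ H] [CompleteSpace H]
    [NormedAddCommGroup F] [NormedSpace ℝ F] [CompleteSpace F]
    (p : ℕ) (hp : 1 ≤ p) (q : ℕ∞) (hbump : SepOp.HasBump (p : ℕ∞) G)
    (X : TopologicalSpace.Opens G) (Y : TopologicalSpace.Opens H)
    (T : SepOp.Ck (p : ℕ∞) X E →ₗ[ℝ] SepOp.Ck q Y F)
    (hsep : SepOp.Separating T) (hnt : SepOp.NowhereTrivial T) (hcont : Continuous T)
    (y₀ : Y) (i : ℕ) (hi : i ≤ p) (hΦ : ∃ S : SepOp.SymMul i G E, SepOp.coeff T i y₀ S ≠ 0)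
    (q' : ℕ) (hq' : (q' : ℕ∞) ≤ q) :
    ∃ r : ℝ, 0 < r ∧ Metric.ball (y₀ : H) r ⊆ Y ∧ ∃ C : ℝ,
      ∀ y : Y, (y : H) ∈ Metric.ball (y₀ : H) r →
        SepOp.supportMap T y ≠ SepOp.supportMap T y₀ →
        ‖SepOp.supportMap T y - SepOp.supportMap T y₀‖ ^ (p - i) ≤
          C * ‖(y : H) - (y₀ : H)‖ ^ q' := by
  choose h hh using SepOp.exists_isSupportPoint hbump hcont hnt
  have hmap : ∀ y, SepOp.supportMap T y = h y := fun y => (hh y).supportMap_eq hsep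
  obtain ⟨S, hS⟩ := hΦ
  have hS' : T (SepOp.monomial p X S (h y₀ : G)) y₀ ≠ 0 := by
    rw [← hmap]
    exact fun h0 => hS (by rw [SepOp.coeff, h0, smul_zero])
  obtain ⟨r, hr, hrY⟩ := Metric.isOpen_iff.1 Y.isOpen y₀ y₀.2
  simp only [hmap]
  by_contra! hcon
  have hpos : ∀ n : ℕ, 0 < r / (n + 1) := fun n => by positivity
  have hle : ∀ n : ℕ, r / (n + 1) ≤ r := fun n =>
    div_le_self hr.le (by linarith [n.cast_nonneg (α := ℝ)])
  -- At stage `n` the claim fails with radius `r / (n + 1)` and constant `n`, which eventually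
  -- exceeds the constant valid along `u`.
  choose u hu hune hulow using fun n : ℕ =>
    hcon (r / (n + 1)) (hpos n) ((Metric.ball_subset_ball (hle n)).trans hrY) n
  have hlim : Filter.Tendsto u Filter.atTop (nhds y₀) := by
    rw [tendsto_iff_dist_tendsto_zero]
    refine squeeze_zero (fun _ => dist_nonneg) (fun n => le_of_lt (hu n)) ?_
    exact tendsto_const_nhds.div_atTop
      (Filter.tendsto_atTop_add_const_right _ _ tendsto_natCast_atTop_atTop)
  obtain ⟨C, hC⟩ := SepOp.exists_uniform_bound_of_isSupportPoint hbump hcont hsep hnt hh hi S hS'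
    hq' hrY (fun n => Metric.ball_subset_ball (hle n) (hu n)) hlim
  obtain ⟨n, hn, hCn⟩ := (hC.and (tendsto_natCast_atTop_atTop.eventually_ge_atTop C)).exists
  refine absurd (hn fun he => hune n (by rw [he])) (not_le.2 ((?_ : _ ≤ _).trans_lt (hulow n)))
  gcongr
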